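/- All graphs are finite and simple. A graph $H$ is a topological minor of a graph $G$ if some subdivision of $H$ (a graph obtained from $H$ by replacing its edges by pairwise internally disjoint paths) is a subgraph of $G$. Let $r\in\mathbb N$. A linear order on $V(G)$ is represented by an injective function $L\colon V(G)\to\mathbb N$. For $v\in V(G)$ let $\mathrm{WReach}_r[G,L,v]$ be the set of vertices $u$ for which there is a path $P$ of length at most $r$ from $v$ to $u$ with $L(u)\le L(w)$ for all $w\in V(P)$, and let $\mathrm{adm}_r[G,L,v]$ be the maximum size of a set of paths of length at most $r$ in $G$ that start in $v$, end in a vertex $w$ with $L(w)\le L(v)$, and pairwise have exactly the vertex $v$ in common (the path of length $0$ is allowed). Put $$\mathrm{wcol}_r(G)=\min_L\max_{v\in V(G)}|\mathrm{WReach}_r[G,L,v]|,\qquad \mathrm{adm}_r(G)=\min_L\max_{v\in V(G)}\mathrm{adm}_r[G,L,v],$$ where a maximum over the empty set is $0$. **Corollary.** Let $\mathcal C$ be a class of graphs that excludes some fixed graph $H$ as a topological minor, that is, $H$ is not a topological minor of any $G\in\mathcal C$. Then: 1. There is a constant $c$, depending only on $\mathcal C$, such that $\mathrm{adm}_r(G)\le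 c\,r$ for all $G\in\mathcal C$ and all integers $r\ge 1$. 2. For every $\varepsilon>0$ there is a constant $c$, depending only on $\mathcal C$ and $\varepsilon$, such that $\mathrm{wcol}_r(G)\le c\,r^{(1+\varepsilon)r}$ for all $G\in\mathcal C$ and all integers $r\ge1$. -/

import Mathlib

universe u v

namespace SimpleGraph

variable {V : Type u} {W : Type v}

/-- `H` is a topological minor of `G`: some subdivision of `H` is a subgraph of `G`. The vertices
of `H` are sent injectively to branch vertices of `G`, and every edge of `H` is replaced by a path
of `G` between the corresponding branch vertices (the two orientations of an edge give the same
path, traversed in opposite directions). No inner vertex of these paths is a branch vertex, and the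
paths belonging to different edges of `H` meet only in branch vertices. -/
def IsTopologicalMinor (H : SimpleGraph W) (G : SimpleGraph V) : Prop :=
  ∃ (b : W ↪ V) (p : ∀ d : H.Dart, G.Walk (b d.fst) (b d.snd)),
    (∀ d, (p d).IsPath) ∧
    (∀ d, p d.symm = (p d).reverse) ∧
    (∀ d w, b w ∈ (p d).support → w = d.fst ∨ w = d.snd) ∧
    (∀ d d', d.edge ≠ d'.edge → ∀ x, x ∈ (p d).support → x ∈ (p d').support → ∃ w, x = b w)

/-- The set of vertices that are weakly `r`-reachable from `x` with respect to the linear order on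
the vertices that is represented by the injective function `L`. -/
def wReach (G : SimpleGraph V) (L : V ↪ ℕ) (r : ℕ) (x : V) : Set V :=
  {y | ∃ P : G.Walk x y, P.IsPath ∧ P.length ≤ r ∧ ∀ w ∈ P.support, L y ≤ L w}

/-- The weak `r`-colouring number of a finite graph: the minimum over all linear orders of the
maximum size of a set of weakly `r`-reachable vertices (the maximum over no vertices is `0`). -/
noncomputable def wcol (G : SimpleGraph V) (r : ℕ) : ℕ :=
  ⨅ L : V ↪ ℕ, ⨆ x : V, (G.wReach L r x).ncard

/-- `F` is a family of paths of length at most `r` that start in `x`, end in a vertex that is at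
most `x` in the order, and pairwise meet exactly in `x`. The path of length `0` is allowed. -/
def IsAdmFamily (G : SimpleGraph V) (L : V ↪ ℕ) (r : ℕ) (x : V)
    (F : Finset (Σ y : V, G.Path x y)) : Prop :=
  (∀ P ∈ F, (P.2 : G.Walk x P.1).length ≤ r ∧ L P.1 ≤ L x) ∧
  ∀ P ∈ F, ∀ Q ∈ F, P ≠ Q →
    {z | z ∈ (P.2 : G.Walk x P.1).support} ∩ {z | z ∈ (Q.2 : G.Walk x Q.1).support} = {x}

/-- The `r`-admissibility of the vertex `x` with respect to `L`, that is, the maximum size of a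
family of paths as above. -/
noncomputable def admAt (G : SimpleGraph V) (L : V ↪ ℕ) (r : ℕ) (x : V) : ℕ :=
  sSup {k | ∃ F : Finset (Σ y : V, G.Path x y), G.IsAdmFamily L r x F ∧ F.card = k}

/-- The `r`-admissibility of a finite graph (the maximum over no vertices is `0`). -/
noncomputable def adm (G : SimpleGraph V) (r : ℕ) : ℕ :=
  ⨅ L : V ↪ ℕ, ⨆ x : V, G.admAt L r x

/-- In a finite graph the supremum in `admAt` is a maximum: the sizes in question are bounded by
the number of vertices. -/
theorem IsAdmFamily.card_le [Finite V] {G : SimpleGraph V} {L : V ↪ ℕ} {r : ℕ} {x : V}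
    {F : Finset (Σ y : V, G.Path x y)} (hF : G.IsAdmFamily L r x F) : F.card ≤ Nat.card V := by
  have := Fintype.ofFinite V
  rw [Nat.card_eq_fintype_card, ← Finset.card_univ]
  refine Finset.card_le_card_of_injOn Sigma.fst (fun _ _ => Finset.mem_coe.2 (Finset.mem_univ _)) ?_
  rintro ⟨y, P⟩ hP ⟨z, Q⟩ hQ (h : y = z)
  subst h
  by_contra hne
  have hy : y ∈ ({x} : Set V) := by
    rw [← hF.2 _ hP _ hQ hne]
    exact ⟨Walk.end_mem_support _, Walk.end_mem_support _⟩
  rw [Set.mem_singleton_iff] at hy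
  subst hy
  exact hne (by rw [Path.loop_eq P, Path.loop_eq Q])

end SimpleGraph

/-!
By Mader's theorem a dense graph contains `H` as a topological minor: contract a connected set whose
neighbourhood is still dense, use that set to realise one edge of `H`, and look for the rest of `H`
in the neighbourhood. So a graph `G` without `H`, and every graph of which `G` contains a
subdivision, is sparse.

Suppose that every vertex of a set `S` were the centre of many short paths to `S`. Take a graph `K`
on `S`, maximal with a subdivision in `G` whose paths are short. It is sparse, hence has a large
independent set `R`, and the set `A` of the vertices of the subdivision is not much larger than `S`.
Cut the paths at their first vertex in `A`. By the maximality of `K`, cut paths with different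
centres in `R` are disjoint, so they form a subdivision with branch set `A` of a graph that is too
dense. Hence every `S` has a vertex with few such paths, and removing these vertices one by one
gives an order that witnesses `adm_r(G) ≤ c r`.

For `wcol`, search breadth-first from `x` among the vertices that are at least `x`. The tree paths
from a vertex to leaves below `x` through different children form an admissible family, so at most
`k = adm_r(G)` children of a vertex lead to such leaves, and at most `k ^ s` vertices below `x` are
reached within `s` steps. Splitting a path at its first vertex below `x` gives
`|WReach_n| ≤ 1 + ∑_{i < n} k ^ (n - i) (2 k) ^ i ≤ (2 k) ^ n`, and
`(2 c r) ^ r ≤ c' r ^ ((1 + ε) r)`.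
-/

section TopologicalModel

open SimpleGraph

variable {V W X : Type*}

/-- `u` and `v` are joined by a walk of `G` that stays inside `B`. -/
def ReachableWithin (G : SimpleGraph V) (B : Set V) (u v : V) : Prop :=
  ∃ p : G.Walk u v, ∀ x ∈ p.support, x ∈ B

namespace ReachableWithin

variable {G : SimpleGraph V} {B C : Set V} {u v w : V}

lemma refl (hu : u ∈ B) : ReachableWithin G B u u :=
  ⟨.nil, by simpa using hu⟩

lemma of_adj (h : G.Adj u v) (hu : u ∈ B) (hv : v ∈ B) : ReachableWithin G B u v :=
  ⟨h.toWalk, by simp [hu, hv]⟩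

lemma symm : ReachableWithin G B u v → ReachableWithin G B v u
  | ⟨p, hp⟩ => ⟨p.reverse, by simpa using hp⟩

lemma trans : ReachableWithin G B u v → ReachableWithin G B v w → ReachableWithin G B u w
  | ⟨p, hp⟩, ⟨q, hq⟩ => ⟨p.append q, fun x hx =>
      ((p.mem_support_append_iff q).1 hx).elim (hp x) (hq x)⟩

lemma mono (hBC : B ⊆ C) : ReachableWithin G B u v → ReachableWithin G C u v
  | ⟨p, hp⟩ => ⟨p, fun x hx => hBC (hp x hx)⟩

lemma exists_isPath : ReachableWithin G B u v →
    ∃ p : G.Walk u v, p.IsPath ∧ ∀ x ∈ p.support, x ∈ B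
  | ⟨p, hp⟩ => by
    classical
    exact ⟨p.bypass, p.bypass_isPath, fun x hx => hp x (p.support_bypass_subset_support hx)⟩

lemma lift {K : SimpleGraph X} {D : Set X} {f : X → V} {x y : X}
    (h : ReachableWithin K D x y) (hf : ∀ z ∈ D, f z ∈ C)
    (hadj : ∀ z ∈ D, ∀ z' ∈ D, K.Adj z z' → ReachableWithin G C (f z) (f z')) :
    ReachableWithin G C (f x) (f y) := by
  obtain ⟨p, hp⟩ := h
  induction p with
  | nil => exact refl (hf _ (hp _ (by simp)))
  | cons hzz' p ih =>
    have hpD : ∀ z ∈ p.support, z ∈ D := fun z hz => hp z (by simp [hz])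
    exact (hadj _ (hp _ (by simp)) _ (hpD _ p.start_mem_support) hzz').trans (ih hpD)

lemma of_preconnected_induce (hB : (G.induce B).Preconnected) (hu : u ∈ B) (hv : v ∈ B) :
    ReachableWithin G B u v := by
  obtain ⟨p⟩ := hB ⟨u, hu⟩ ⟨v, hv⟩
  exact lift (f := Subtype.val) (D := Set.univ) ⟨p, fun _ _ => Set.mem_univ _⟩
    (fun z _ => z.2) fun z _ z' _ h => of_adj h z.2 z'.2

lemma of_adj_of_preconnected_induce (hB : (G.induce B).Preconnected) (hu : ∃ x ∈ B, G.Adj u x)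
    (hv : ∃ y ∈ B, G.Adj v y) : ReachableWithin G (insert u (insert v B)) u v := by
  obtain ⟨x, hx, hux⟩ := hu
  obtain ⟨y, hy, hvy⟩ := hv
  have hxy := (of_preconnected_induce hB hx hy).mono
    ((Set.subset_insert v B).trans (Set.subset_insert u _))
  exact (of_adj hux (by simp) (by simp [hx])).trans
    (hxy.trans (of_adj hvy (by simp) (by simp [hy])).symm)

end ReachableWithin

/-- The vertices available to the path that replaces the edge `e`, if `b` gives the branch vertices
and `I` the sets of inner vertices. -/
def edgeSegment (b : W ↪ V) (I : Sym2 W → Set V) (e : Sym2 W) : Set V :=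
  b '' {w | w ∈ e} ∪ I e

lemma mem_edgeSegment_mk {b : W ↪ V} {I : Sym2 W → Set V} {a c : W} {x : V} :
    x ∈ edgeSegment b I s(a, c) ↔ x = b a ∨ x = b c ∨ x ∈ I s(a, c) := by
  simp [edgeSegment, or_and_right, exists_or, eq_comm, or_assoc]

/-- A set-valued form of a topological minor: `b` gives the branch vertices, and the edges of `H`
receive disjoint sets `I e` through which their ends can be connected in `G`. Only membership in
`I e` is prescribed, so that models can be composed without keeping track of the paths. -/
structure IsTopologicalModel (H : SimpleGraph W) (G : SimpleGraph V) (b : W ↪ V)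
    (I : Sym2 W → Set V) : Prop where
  branch_notMem : ∀ w e, b w ∉ I e
  pairwiseDisjoint : H.edgeSet.PairwiseDisjoint I
  reachableWithin : ∀ ⦃a c⦄, H.Adj a c → ReachableWithin G (edgeSegment b I s(a, c)) (b a) (b c)

lemma exists_walk_symm_eq_reverse {H : SimpleGraph W} {G : SimpleGraph V} {f : W → V}
    {P : ∀ d : H.Dart, G.Walk (f d.fst) (f d.snd) → Prop} (hP : ∀ d, ∃ p, P d p)
    (hP_reverse : ∀ d p, P d p → P d.symm p.reverse) :
    ∃ p : ∀ d : H.Dart, G.Walk (f d.fst) (f d.snd),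
      (∀ d, P d (p d)) ∧ ∀ d, p d.symm = (p d).reverse := by
  classical
  choose q hq using hP
  let _ : LinearOrder W := linearOrderOfSTO WellOrderingRel
  let p : ∀ d : H.Dart, G.Walk (f d.fst) (f d.snd) := fun d =>
    if d.fst < d.snd then q d else (q d.symm).reverse
  have p_of_lt : ∀ d : H.Dart, d.fst < d.snd → p d = q d := fun d h => if_pos h
  have p_of_gt : ∀ d : H.Dart, d.snd < d.fst → p d = (q d.symm).reverse :=
    fun d h => if_neg h.not_gt
  refine ⟨p, fun d => ?_, fun d => ?_⟩ <;> rcases d.adj.ne.lt_or_gt with h | h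
  · exact p_of_lt d h ▸ hq d
  · exact p_of_gt d h ▸ hP_reverse d.symm _ (hq d.symm)
  · exact (p_of_gt d.symm h).trans (congrArg Walk.reverse (p_of_lt d h).symm)
  · exact (p_of_lt d.symm h).trans <|
      (Walk.reverse_reverse _).symm.trans (congrArg Walk.reverse (p_of_gt d h).symm)

namespace IsTopologicalModel

variable {H : SimpleGraph W} {K : SimpleGraph X} {G : SimpleGraph V}

theorem isTopologicalMinor {b : W ↪ V} {I : Sym2 W → Set V} (h : IsTopologicalModel H G b I) :
    H.IsTopologicalMinor G := by
  obtain ⟨p, hp, hp_symm⟩ := exists_walk_symm_eq_reverse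
    (P := fun d p => p.IsPath ∧ ∀ x ∈ p.support, x ∈ edgeSegment b I d.edge)
    (fun d => (h.reachableWithin d.adj).exists_isPath)
    (fun d p hp => by
      refine ⟨hp.1.reverse, fun x hx => ?_⟩
      rw [Dart.edge_symm]
      exact hp.2 x (List.mem_reverse.1 (p.support_reverse ▸ hx)))
  refine ⟨b, p, fun d => (hp d).1, hp_symm, fun d w hw => ?_, fun d d' hne x hx hx' => ?_⟩
  · rcases mem_edgeSegment_mk.1 ((hp d).2 _ hw) with hw | hw | hw
    exacts [.inl (b.injective hw), .inr (b.injective hw), absurd hw (h.branch_notMem _ _)]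
  · rcases (hp d).2 x hx with ⟨w, -, rfl⟩ | hxI
    · exact ⟨w, rfl⟩
    rcases (hp d').2 x hx' with ⟨w, -, rfl⟩ | hxI'
    · exact ⟨w, rfl⟩
    exact absurd hxI' (Set.disjoint_left.1 (h.pairwiseDisjoint d.edge_mem d'.edge_mem hne) hxI)

lemma eq_of_subset_edgeSegment {b : W ↪ X} {I : Sym2 W → Set X} (h : IsTopologicalModel H K b I)
    {e e' : Sym2 W} (he : e ∈ H.edgeSet) (he' : e' ∈ H.edgeSet) {f : Sym2 X} (hf : f ∈ K.edgeSet)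
    (hfe : ∀ x ∈ f, x ∈ edgeSegment b I e) (hfe' : ∀ x ∈ f, x ∈ edgeSegment b I e') : e = e' := by
  by_contra hne
  have common_branch : ∀ x ∈ f, ∃ w, (w ∈ e ∧ w ∈ e') ∧ b w = x := by
    intro x hx
    rcases hfe x hx, hfe' x hx with ⟨⟨w, hw, rfl⟩ | hxI, ⟨w', hw', hww'⟩ | hxI'⟩
    · exact ⟨w, ⟨hw, b.injective hww' ▸ hw'⟩, rfl⟩
    · exact absurd hxI' (h.branch_notMem _ _)
    · exact absurd (hww' ▸ hxI) (h.branch_notMem _ _)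
    · exact absurd hxI' (Set.disjoint_left.1 (h.pairwiseDisjoint he he' hne) hxI)
  induction f with
  | _ x y =>
    obtain ⟨w, ⟨hwe, hwe'⟩, rfl⟩ := common_branch x (Sym2.mem_mk_left _ _)
    obtain ⟨w', ⟨hwe₁, hwe₁'⟩, rfl⟩ := common_branch y (Sym2.mem_mk_right _ _)
    have hww' : w ≠ w' := fun h => (mem_edgeSet K).1 hf |>.ne (congrArg b h)
    exact hne (((Sym2.mem_and_mem_iff hww').1 ⟨hwe, hwe₁⟩).trans
      ((Sym2.mem_and_mem_iff hww').1 ⟨hwe', hwe₁'⟩).symm)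

/-- The inner sets of the composition of a model `(b, I)` in `K` with a model `(b', I')` of `K`: the
inner vertices in `K`, and those of every edge of `K` whose ends both lie in the segment. -/
def expandInner (K : SimpleGraph X) (b : W ↪ X) (I : Sym2 W → Set X) (b' : X ↪ V)
    (I' : Sym2 X → Set V) (e : Sym2 W) : Set V :=
  b' '' I e ∪ ⋃ f ∈ {f ∈ K.edgeSet | ∀ x ∈ f, x ∈ edgeSegment b I e}, I' f

theorem trans {b : W ↪ X} {I : Sym2 W → Set X} {b' : X ↪ V} {I' : Sym2 X → Set V}
    (h : IsTopologicalModel H K b I) (h' : IsTopologicalModel K G b' I') :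
    IsTopologicalModel H G (b.trans b') (expandInner K b I b' I') where
  branch_notMem w e := by
    rintro (⟨x, hx, hxw⟩ | hw)
    · exact h.branch_notMem w e (b'.injective hxw ▸ hx)
    · obtain ⟨f, -, hf⟩ := Set.mem_iUnion₂.1 hw
      exact h'.branch_notMem _ f hf
  pairwiseDisjoint e he e' he' hne := by
    simp only [Function.onFun, expandInner, Set.disjoint_union_left, Set.disjoint_union_right,
      Set.disjoint_iUnion_left, Set.disjoint_iUnion_right]
    refine ⟨⟨?_, fun f _ => ?_⟩, fun f hf => ⟨?_, fun f' hf' => ?_⟩⟩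
    · exact (Set.disjoint_image_iff b'.injective).2 (h.pairwiseDisjoint he he' hne)
    · exact Set.disjoint_right.2 (by rintro _ ⟨x, -, rfl⟩; exact h'.branch_notMem x f)
    · exact Set.disjoint_left.2 (by rintro _ ⟨x, -, rfl⟩; exact h'.branch_notMem x f)
    · refine h'.pairwiseDisjoint hf'.1 hf.1 ?_
      rintro rfl
      exact hne (h.eq_of_subset_edgeSegment he he' hf.1 hf'.2 hf.2)
  reachableWithin a c hac := by
    have edgeSegment_subset : ∀ x ∈ edgeSegment b I s(a, c),
        b' x ∈ edgeSegment (b.trans b') (expandInner K b I b' I') s(a, c) := by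
      rintro _ (⟨w, hw, rfl⟩ | hx)
      exacts [.inl ⟨w, hw, rfl⟩, .inr (.inl (Set.mem_image_of_mem b' hx))]
    refine (h.reachableWithin hac).lift edgeSegment_subset fun x hx y hy hxy =>
      (h'.reachableWithin hxy).mono fun z hz => ?_
    rcases mem_edgeSegment_mk.1 hz with rfl | rfl | hz
    · exact edgeSegment_subset x hx
    · exact edgeSegment_subset y hy
    · exact .inr (.inr (Set.mem_biUnion ⟨hxy, by simp [hx, hy]⟩ hz))

lemma map {b : W ↪ X} {I : Sym2 W → Set X} (h : IsTopologicalModel H K b I) (f : Copy K G) :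
    IsTopologicalModel H G (b.trans f.toEmbedding) (f '' I ·) where
  branch_notMem w e := by
    rintro ⟨x, hx, hxw⟩
    exact h.branch_notMem w e (f.injective hxw ▸ hx)
  pairwiseDisjoint _ he _ he' hne :=
    (Set.disjoint_image_iff f.injective).2 (h.pairwiseDisjoint he he' hne)
  reachableWithin a c hac := by
    have edgeSegment_subset : ∀ x ∈ edgeSegment b I s(a, c),
        f x ∈ edgeSegment (b.trans f.toEmbedding) (f '' I ·) s(a, c) := by
      rintro _ (⟨w, hw, rfl⟩ | hx)
      exacts [.inl ⟨w, hw, rfl⟩, .inr (Set.mem_image_of_mem f hx)]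
    exact (h.reachableWithin hac).lift edgeSegment_subset fun x hx y hy hxy =>
      .of_adj (f.toHom.map_adj hxy) (edgeSegment_subset x hx) (edgeSegment_subset y hy)

theorem of_deleteEdges [DecidableEq W] {v w : W} {b : W ↪ V} {I : Sym2 W → Set V} {B : Set V}
    (h : IsTopologicalModel (H.deleteEdges {s(v, w)}) G b I) (hbB : ∀ a, b a ∉ B)
    (hIB : ∀ e ∈ (H.deleteEdges {s(v, w)}).edgeSet, Disjoint (I e) B)
    (hB : ReachableWithin G (insert (b v) (insert (b w) B)) (b v) (b w)) :
    IsTopologicalModel H G b (Function.update I s(v, w) B) where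
  branch_notMem a e := by
    rw [Function.update_apply]
    split_ifs
    exacts [hbB a, h.branch_notMem a e]
  pairwiseDisjoint e₁ he₁ e₂ he₂ hne := by
    have mem_deleteEdges : ∀ e ∈ H.edgeSet, e ≠ s(v, w) → e ∈ (H.deleteEdges {s(v, w)}).edgeSet :=
      fun e he hne => by simp [edgeSet_deleteEdges, he, hne]
    simp only [Function.onFun, Function.update_apply]
    split_ifs with h₁ h₂ h₂
    · exact absurd (h₁.trans h₂.symm) hne
    · exact (hIB _ (mem_deleteEdges _ he₂ h₂)).symm
    · exact hIB _ (mem_deleteEdges _ he₁ h₁)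
    · exact h.pairwiseDisjoint (mem_deleteEdges _ he₁ h₁) (mem_deleteEdges _ he₂ h₂) hne
  reachableWithin a c hac := by
    have reachable_vw : ReachableWithin G
        (edgeSegment b (Function.update I s(v, w) B) s(v, w)) (b v) (b w) :=
      hB.mono fun x hx => mem_edgeSegment_mk.2 (by simpa using hx)
    by_cases hvw : s(a, c) = s(v, w)
    · rw [hvw]
      rcases Sym2.eq_iff.1 hvw with ⟨rfl, rfl⟩ | ⟨rfl, rfl⟩
      exacts [reachable_vw, reachable_vw.symm]
    · refine (h.reachableWithin (deleteEdges_adj.2 ⟨hac, hvw⟩)).mono fun x hx => ?_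
      rw [mem_edgeSegment_mk] at hx ⊢
      rwa [Function.update_of_ne hvw]

end IsTopologicalModel

end TopologicalModel

section Contraction

open SimpleGraph Finset

variable {V : Type*} (G : SimpleGraph V) [DecidableRel G.Adj]

lemma card_interedges_eq_sum (A B : Finset V) :
    #(G.interedges A B) = ∑ v ∈ A, #{w ∈ B | G.Adj v w} := by
  simp only [interedges_def, card_filter, sum_product]

lemma mul_card_le_card_interedges {A B : Finset V} {D : ℕ}
    (h : ∀ v ∈ A, D ≤ #{w ∈ B | G.Adj v w}) : D * #A ≤ #(G.interedges A B) := by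
  rw [card_interedges_eq_sum, mul_comm, ← smul_eq_mul]
  exact A.card_nsmul_le_sum _ D h

lemma card_interedges_induce_univ (N : Finset V) :
    #((G.induce (N : Set V)).interedges univ univ) = #(G.interedges N N) := by
  refine card_nbij (fun e => (e.1.1, e.2.1)) (fun e he => ?_) (fun e _ e' _ h => ?_)
    fun e he => ?_
  · rw [mem_coe, mem_interedges_iff] at he
    exact (mk_mem_interedges_iff G).2 ⟨e.1.2, e.2.2, he.2.2⟩
  · rw [Prod.mk.injEq] at h
    exact Prod.ext (Subtype.ext h.1) (Subtype.ext h.2)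
  · rw [mem_coe, mem_interedges_iff] at he
    exact ⟨(⟨e.1, he.1⟩, ⟨e.2, he.2.1⟩), by simpa [mem_interedges_iff] using he.2.2, rfl⟩

variable [DecidableEq V]

lemma card_interedges_erase_add {A : Finset V} {v : V} (hv : v ∈ A) :
    #(G.interedges (A.erase v) (A.erase v)) + 2 * #{w ∈ A | G.Adj v w} =
      #(G.interedges A A) := by
  have degree_eq : ∀ u ∈ A.erase v, #{w ∈ A | G.Adj u w} =
      #{w ∈ A.erase v | G.Adj u w} + if G.Adj v u then 1 else 0 := by
    intro u _
    rw [filter_erase, card_erase_eq_ite]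
    by_cases h : G.Adj v u
    · have hu : v ∈ {w ∈ A | G.Adj u w} := by simp [hv, h.symm]
      simp [h, h.symm, hv, Nat.sub_add_cancel (card_pos.2 ⟨v, hu⟩)]
    · simp [h, G.adj_comm u v]
  have degree_erase : #{u ∈ A.erase v | G.Adj v u} = #{w ∈ A | G.Adj v w} := by
    rw [filter_erase, erase_eq_of_notMem (by simp)]
  rw [card_interedges_eq_sum, card_interedges_eq_sum, ← add_sum_erase A _ hv,
    sum_congr rfl degree_eq, sum_add_distrib, ← card_filter, degree_erase]
  ring

/-- The neighbours of `U` in `A \ U`. -/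
def outerNeighborFinset (A U : Finset V) : Finset V :=
  {v ∈ A \ U | ∃ u ∈ U, G.Adj v u}

/-- The degree sum of the graph obtained from `G[A]` by contracting `U` to a single vertex. -/
def contractionDegreeSum (A U : Finset V) : ℕ :=
  #(G.interedges (A \ U) (A \ U)) + 2 * #(outerNeighborFinset G A U)

lemma contractionDegreeSum_singleton {A : Finset V} {v : V} (hv : v ∈ A) :
    contractionDegreeSum G A {v} = #(G.interedges A A) := by
  have outer_eq : outerNeighborFinset G A {v} = {w ∈ A | G.Adj v w} := by
    ext w
    simp only [outerNeighborFinset, mem_filter, mem_sdiff, mem_singleton, exists_eq_left,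
      G.adj_comm w v]
    exact ⟨fun h => ⟨h.1.1, h.2⟩, fun h => ⟨⟨h.1, h.2.ne'⟩, h.2⟩⟩
  rw [contractionDegreeSum, outer_eq, sdiff_singleton_eq_erase, card_interedges_erase_add G hv]

lemma contractionDegreeSum_le_insert {A U : Finset V} {v : V}
    (hv : v ∈ outerNeighborFinset G A U) :
    contractionDegreeSum G A U ≤ contractionDegreeSum G A (insert v U) +
      2 * (#{w ∈ outerNeighborFinset G A U | G.Adj v w} + 1) := by
  have hv' : v ∈ A \ U := (mem_filter.1 hv).1
  have outer_subset : outerNeighborFinset G A U ∪ {w ∈ A \ U | G.Adj v w} ⊆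
      insert v (outerNeighborFinset G A (insert v U)) := by
    intro w
    simp only [outerNeighborFinset, mem_union, mem_filter, mem_sdiff, mem_insert, G.adj_comm v w,
      exists_eq_or_imp]
    tauto
  have inter_eq : outerNeighborFinset G A U ∩ {w ∈ A \ U | G.Adj v w} =
      {w ∈ outerNeighborFinset G A U | G.Adj v w} := by
    ext w
    simp only [outerNeighborFinset, mem_inter, mem_filter]
    tauto
  have card_outer := (card_le_card outer_subset).trans (card_insert_le _ _)
  have card_union := card_union_add_card_inter (outerNeighborFinset G A U) {w ∈ A \ U | G.Adj v w}
  rw [inter_eq] at card_union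
  rw [contractionDegreeSum, contractionDegreeSum, ← card_interedges_erase_add G hv',
    ← sdiff_insert]
  omega

/-- Contracting one more vertex of the neighbourhood of a maximal `U` destroys the average degree
`2 * D`, so that vertex has at least `D` neighbours in common with the contracted vertex. -/
lemma exists_connected_contraction {A : Finset V} (hA : A.Nonempty) {D : ℕ}
    (h : 2 * D * #A ≤ #(G.interedges A A)) :
    ∃ U ⊆ A, (G.induce (U : Set V)).Connected ∧
      2 * D * (#(A \ U) + 1) ≤ contractionDegreeSum G A U ∧
      ∀ v ∈ outerNeighborFinset G A U, D ≤ #{w ∈ outerNeighborFinset G A U | G.Adj v w} := by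
  let IsDense (U : Finset V) : Prop := U ⊆ A ∧ (G.induce (U : Set V)).Connected ∧
    2 * D * (#(A \ U) + 1) ≤ contractionDegreeSum G A U
  obtain ⟨a, ha⟩ := hA
  have isDense_singleton : IsDense {a} := by
    refine ⟨singleton_subset_iff.2 ha, ?_, ?_⟩
    · rw [coe_singleton]
      exact ⟨.of_subsingleton⟩
    · rwa [contractionDegreeSum_singleton G ha, sdiff_singleton_eq_erase, card_erase_add_one ha]
  obtain ⟨U, hU⟩ := (A.powerset.finite_toSet.subset fun U (hU : IsDense U) =>
    mem_coe.2 (mem_powerset.2 hU.1)).exists_maximal ⟨_, isDense_singleton⟩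
  obtain ⟨hUA, hU_conn, hU_sum⟩ := hU.prop
  refine ⟨U, hUA, hU_conn, hU_sum, fun v hv => ?_⟩
  have ⟨hvAU, u, hu, hvu⟩ := mem_filter.1 hv
  have ⟨hvA, hvU⟩ := mem_sdiff.1 hvAU
  have insert_conn : (G.induce (insert v U : Finset V)).Connected := by
    rw [coe_insert, Set.insert_eq]
    exact connected_induce_union .of_subsingleton hU_conn.preconnected rfl hu hvu
  have insert_sum : contractionDegreeSum G A (insert v U) < 2 * D * (#(A \ insert v U) + 1) := by
    by_contra! hge
    exact hvU (hU.le_of_ge ⟨insert_subset hvA hUA, insert_conn, hge⟩ (subset_insert v U)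
      (mem_insert_self v U))
  have step := contractionDegreeSum_le_insert G hv
  rw [sdiff_insert, card_erase_add_one hvAU] at insert_sum
  rw [mul_add_one] at hU_sum
  omega

omit [DecidableEq V] in
lemma exists_connected_dense_neighborhood {A : Finset V} (hA : A.Nonempty) {D : ℕ} (hD : 0 < D)
    (h : 2 * D * #A ≤ #(G.interedges A A)) :
    ∃ U N : Finset V, (G.induce (U : Set V)).Connected ∧ N.Nonempty ∧ Disjoint N U ∧
      (∀ v ∈ N, ∃ u ∈ U, G.Adj v u) ∧ D * #N ≤ #(G.interedges N N) := by
  classical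
  induction A using Finset.strongInduction with
  | H A ih =>
    obtain ⟨U, hUA, hU_conn, hU_sum, hdeg⟩ := exists_connected_contraction G hA h
    rcases (outerNeighborFinset G A U).eq_empty_or_nonempty with hN | hN
    · rw [contractionDegreeSum, hN, card_empty, mul_zero, add_zero] at hU_sum
      have sdiff_nonempty : (A \ U).Nonempty := by
        rw [nonempty_iff_ne_empty]
        intro hAU
        rw [hAU, interedges_empty_left, card_empty, card_empty] at hU_sum
        omega
      have hU : U.Nonempty := by simpa [Finset.Nonempty] using hU_conn.nonempty
      exact ih (A \ U) (sdiff_ssubset hUA hU) sdiff_nonempty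
        ((Nat.mul_le_mul_left _ (Nat.le_succ _)).trans hU_sum)
    · exact ⟨U, _, hU_conn, hN, disjoint_of_subset_left (filter_subset _ _) sdiff_disjoint,
        fun v hv => (mem_filter.1 hv).2, mul_card_le_card_interedges G hdeg⟩

end Contraction

section Mader

open SimpleGraph Finset

lemma exists_isTopologicalModel_of_edgeSet_eq_empty {V W : Type*} [Finite W] {H : SimpleGraph W}
    (hH : H.edgeSet = ∅) {G : SimpleGraph V} {A : Finset V} (hA : Nat.card W ≤ #A) :
    ∃ b I, IsTopologicalModel H G b I := by
  have := Fintype.ofFinite W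
  obtain ⟨b⟩ : Nonempty (W ↪ A) := Function.Embedding.nonempty_of_card_le (by
    rwa [Fintype.card_coe, ← Nat.card_eq_fintype_card])
  refine ⟨b.trans (.subtype _), fun _ => ∅, by simp, by simp [hH], fun a c hac => ?_⟩
  exact absurd (hH ▸ (mem_edgeSet H).2 hac) (Set.notMem_empty _)

/-- The degree bound in Mader's theorem. It doubles with every edge of `H`, since one contraction
is spent on each edge. -/
noncomputable def maderBound {W : Type*} (H : SimpleGraph W) : ℕ :=
  2 ^ H.edgeSet.ncard * (Nat.card W + 1)

lemma maderBound_pos {W : Type*} [Finite W] (H : SimpleGraph W) : 0 < maderBound H := by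
  unfold maderBound; positivity

/-- Mader's theorem. An edge of `H` is routed through the contracted set `U`, and the rest of `H` is
found in the dense neighbourhood `N` of `U`. -/
theorem exists_isTopologicalModel_of_maderBound_le {V W : Type*} [Finite W] (H : SimpleGraph W)
    (G : SimpleGraph V) [DecidableRel G.Adj] {A : Finset V} (hA : A.Nonempty)
    (h : maderBound H * #A ≤ #(G.interedges A A)) : ∃ b I, IsTopologicalModel H G b I := by
  classical
  rcases hH : H.edgeSet.ncard with _ | m
  · rw [maderBound, hH, pow_zero, one_mul] at h
    have hcard : Nat.card W + 1 ≤ #A :=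
      Nat.le_of_mul_le_mul_right (h.trans (card_interedges_le_mul G A A)) hA.card_pos
    exact exists_isTopologicalModel_of_edgeSet_eq_empty
      ((Set.ncard_eq_zero H.edgeSet.toFinite).1 hH) (Nat.le_of_succ_le hcard)
  · obtain ⟨e, he⟩ := (Set.ncard_pos H.edgeSet.toFinite).1 (by omega)
    induction e with | _ a c => ?_
    have maderBound_eq : maderBound H = 2 * maderBound (H.deleteEdges {s(a, c)}) := by
      rw [maderBound, maderBound, edgeSet_deleteEdges,
        ← Set.ncard_sdiff_singleton_add_one he, pow_succ']
      ring
    obtain ⟨U, N, hU, hN, hNU, hadj, hNN⟩ := exists_connected_dense_neighborhood G hA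
      (maderBound_pos (H.deleteEdges {s(a, c)})) (maderBound_eq ▸ h)
    rw [← card_interedges_induce_univ] at hNN
    have : Nonempty N := hN.to_subtype
    obtain ⟨b, I, hbI⟩ := exists_isTopologicalModel_of_maderBound_le (H.deleteEdges {s(a, c)})
      (G.induce (N : Set V)) (A := univ) univ_nonempty (by simpa using hNN)
    have notMem_U : ∀ x : N, (x : V) ∉ U := fun x => Finset.disjoint_left.1 hNU x.2
    refine ⟨_, _, (hbI.map (Copy.induce G N)).of_deleteEdges (fun w => notMem_U (b w))
      (fun e _ => Set.disjoint_left.2 ?_)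
      (.of_adj_of_preconnected_induce hU.preconnected (hadj _ (b a).2) (hadj _ (b c).2))⟩
    rintro _ ⟨x, -, rfl⟩
    exact notMem_U x
termination_by H.edgeSet.ncard
decreasing_by
  rw [edgeSet_deleteEdges]
  exact Set.ncard_sdiff_singleton_lt_of_mem he

end Mader

section Sparsity

open SimpleGraph Finset

variable {V W X : Type*}

lemma exists_isIndepSet_of_card_interedges_lt {K : SimpleGraph V}
    [DecidableRel K.Adj] {D : ℕ} (S : Finset V)
    (h : ∀ T ⊆ S, T.Nonempty → #(K.interedges T T) < D * #T) :
    ∃ R ⊆ S, K.IsIndepSet R ∧ #S ≤ D * #R := by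
  classical
  induction S using Finset.strongInduction with
  | H S ih =>
    rcases S.eq_empty_or_nonempty with rfl | hS
    · exact ⟨∅, empty_subset _, by simp, by simp⟩
    obtain ⟨v, hv, hvD⟩ : ∃ v ∈ S, #{w ∈ S | K.Adj v w} < D := by
      by_contra! hdeg
      exact (h S subset_rfl hS).not_ge (mul_card_le_card_interedges K hdeg)
    set N : Finset V := insert v {w ∈ S | K.Adj v w}
    have hNS : N ⊆ S := insert_subset hv (filter_subset _ _)
    obtain ⟨R, hRS, hR, hcard⟩ := ih (S \ N) (sdiff_ssubset hNS (insert_nonempty _ _))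
      fun T hT => h T (hT.trans sdiff_subset)
    have not_adj : ∀ w ∈ R, w ≠ v ∧ ¬ K.Adj v w := fun w hw => by
      have hw' := mem_sdiff.1 (hRS hw)
      simp only [N, mem_insert, mem_filter, not_or, not_and] at hw'
      exact ⟨hw'.2.1, hw'.2.2 hw'.1⟩
    refine ⟨insert v R, insert_subset hv (hRS.trans sdiff_subset), ?_, ?_⟩
    · rw [IsIndepSet, coe_insert, Set.pairwise_insert]
      exact ⟨hR, fun w hw _ => ⟨(not_adj w hw).2, fun hwv => (not_adj w hw).2 hwv.symm⟩⟩
    · have hN : #N ≤ D := (card_insert_le _ _).trans hvD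
      rw [card_insert_of_notMem fun hvR => (not_adj v hvR).1 rfl, mul_add_one]
      have := card_sdiff_add_card_eq_card hNS
      omega

lemma IsTopologicalModel.card_interedges_lt [Finite W] {H : SimpleGraph W} {K : SimpleGraph X}
    {G : SimpleGraph V} [DecidableRel K.Adj] {b : X ↪ V} {I : Sym2 X → Set V}
    (h : IsTopologicalModel K G b I) (hH : ¬ H.IsTopologicalMinor G) {T : Finset X}
    (hT : T.Nonempty) : #(K.interedges T T) < maderBound H * #T := by
  by_contra! hdense
  obtain ⟨b', I', hbI'⟩ := exists_isTopologicalModel_of_maderBound_le H K hT hdense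
  exact hH (hbI'.trans h).isTopologicalMinor

lemma card_interedges_univ [Fintype X] (K : SimpleGraph X) [DecidableRel K.Adj] :
    #(K.interedges univ univ) = 2 * #K.edgeFinset := by
  classical
  rw [card_interedges_eq_sum, ← K.sum_degrees_eq_twice_card_edges]
  refine sum_congr rfl fun v _ => ?_
  rw [← card_neighborFinset_eq_degree, neighborFinset_eq_filter]

/-- `K` is a maximal graph with such a model, so an edge that could still be added is already
present. -/
lemma exists_saturated_isTopologicalModel (G : SimpleGraph V) (S : Finset V) (ℓ : ℕ) :
    ∃ (K : SimpleGraph S) (J : Sym2 S → Finset V),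
      IsTopologicalModel K G (.subtype (· ∈ S)) (J · : Sym2 S → Set V) ∧ (∀ e, #(J e) ≤ ℓ) ∧
      ∀ (v w : S) (B : Finset V), v ≠ w → #B ≤ ℓ → Disjoint B S →
        (∀ e ∈ K.edgeSet, Disjoint (J e) B) →
        ReachableWithin G (insert ↑v (insert ↑w B)) v w → K.Adj v w := by
  classical
  let IsModelGraph (K : SimpleGraph S) : Prop := ∃ J : Sym2 S → Finset V,
    IsTopologicalModel K G (.subtype (· ∈ S)) (J · : Sym2 S → Set V) ∧ ∀ e, #(J e) ≤ ℓ
  have isModelGraph_bot : IsModelGraph ⊥ := ⟨fun _ => ∅, ⟨by simp, by simp, by simp⟩, by simp⟩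
  obtain ⟨K, hK⟩ := {K | IsModelGraph K}.toFinite.exists_maximal ⟨⊥, isModelGraph_bot⟩
  obtain ⟨J, hJ, hJℓ⟩ := hK.prop
  refine ⟨K, J, hJ, hJℓ, fun v w B hvw hBℓ hBS hJB hB => ?_⟩
  by_contra hadj
  have deleteEdges_eq : (K ⊔ edge v w).deleteEdges {s(v, w)} = K := by
    rw [deleteEdges, ← edge, sup_sdiff_right_self, ((disjoint_edge K).2 hadj).sdiff_eq_left]
  have isModelGraph_sup : IsModelGraph (K ⊔ edge v w) := by
    refine ⟨Function.update J s(v, w) B, ?_, fun e => ?_⟩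
    · change IsTopologicalModel _ G _ ((↑) ∘ Function.update J s(v, w) B)
      rw [Function.comp_update]
      exact (deleteEdges_eq.symm ▸ hJ).of_deleteEdges
        (fun a ha => Finset.disjoint_left.1 hBS ha a.2)
        (fun e he => disjoint_coe.2 (hJB e (deleteEdges_eq ▸ he))) hB
    · rw [Function.update_apply]
      split_ifs
      exacts [hBℓ, hJℓ e]
  exact hadj (hK.le_of_ge isModelGraph_sup le_sup_left (by simp [edge_adj, hvw]))

end Sparsity

section Fan

open SimpleGraph Finset

variable {V W : Type*} {G : SimpleGraph V} {A R S : Finset V} {r k : ℕ} {v w x y : V}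
  {I J : Finset V}

/-- `I` is the set of inner vertices of an `A`-path from `v` to `x`, that is, of a path meeting `A`
only in its two ends. Instead of the path itself we record what it connects inside `I`, since that
is all that is needed to build topological models. -/
structure IsSetPath (G : SimpleGraph V) (A : Finset V) (v x : V) (I : Finset V) : Prop where
  end_mem : x ∈ A
  end_ne : x ≠ v
  disjoint : Disjoint I A
  reachableWithin : ReachableWithin G (insert v (insert x I)) v x
  reachableWithin_of_mem : ∀ z ∈ I, ReachableWithin G (insert v I) v z

/-- `A`-paths of `G` from `v` to the members of `E` whose sets of inner vertices `I x` have at most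
`r` elements and are pairwise disjoint. -/
structure IsFan (G : SimpleGraph V) (A : Finset V) (r : ℕ) (v : V) (E : Finset V)
    (I : V → Finset V) : Prop where
  isSetPath : ∀ x ∈ E, IsSetPath G A v x (I x)
  card_le : ∀ x ∈ E, #(I x) ≤ r
  pairwiseDisjoint : (E : Set V).PairwiseDisjoint I

lemma IsSetPath.reachableWithin_union [DecidableEq V] (hI : IsSetPath G A v x I)
    (hJ : IsSetPath G A w y J) (hIJ : ¬ Disjoint I J) :
    ReachableWithin G (insert v (insert w ↑(I ∪ J))) v w := by
  obtain ⟨z, hzI, hzJ⟩ := Finset.not_disjoint_iff.1 hIJ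
  refine ((hI.reachableWithin_of_mem z hzI).mono ?_).trans
    ((hJ.reachableWithin_of_mem z hzJ).mono ?_).symm
  · grind
  · grind

/-- `E v` consists of the further ends of the `A`-paths starting in `v ∈ R`. -/
def fanGraph (A R : Finset V) (E : V → Finset V) : SimpleGraph A :=
  .fromRel fun a c => ↑a ∈ R ∧ ↑c ∈ E a

/-- The inner vertices of the edge `e` of `fanGraph A R E`. -/
def fanInner (R : Finset V) (E : V → Finset V) (I : V → V → Finset V) (e : Sym2 A) : Set V :=
  {z | ∃ v ∈ R, ∃ x ∈ E v, e.map Subtype.val = s(v, x) ∧ z ∈ I v x}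

lemma isTopologicalModel_fanGraph {E : V → Finset V} {I : V → V → Finset V}
    (hE : ∀ v ∈ R, IsFan G A r v (E v) (I v))
    (hI : ∀ v ∈ R, ∀ w ∈ R, v ≠ w → ∀ x ∈ E v, ∀ y ∈ E w, Disjoint (I v x) (I w y)) :
    IsTopologicalModel (fanGraph A R E) G (.subtype (· ∈ A)) (fanInner R E I) where
  branch_notMem a e := by
    rintro ⟨v, hv, x, hx, -, ha⟩
    exact Finset.disjoint_left.1 ((hE v hv).isSetPath x hx).disjoint ha a.2
  pairwiseDisjoint e _ e' _ hne := by
    refine Set.disjoint_left.2 ?_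
    rintro z ⟨v, hv, x, hx, he, hz⟩ ⟨v', hv', x', hx', he', hz'⟩
    have hvx : s(v, x) ≠ s(v', x') := fun h =>
      hne (Sym2.map.injective Subtype.val_injective (he.trans (h.trans he'.symm)))
    by_cases hvv' : v = v'
    · subst hvv'
      have hxx' : x ≠ x' := by rintro rfl; exact hvx rfl
      exact Finset.disjoint_left.1 ((hE v hv).pairwiseDisjoint hx hx' hxx') hz hz'
    · exact Finset.disjoint_left.1 (hI v hv v' hv' hvv' x hx x' hx') hz hz'
  reachableWithin a c hac := by
    have reachable_of_mem : ∀ a c : A, ↑a ∈ R → ↑c ∈ E a → ReachableWithin G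
        (edgeSegment (.subtype (· ∈ A)) (fanInner R E I) s(a, c)) a c := fun a c ha hc =>
      ((hE a ha).isSetPath c hc).reachableWithin.mono fun z hz => by
        rw [mem_edgeSegment_mk]
        exact hz.imp_right (.imp_right fun hzI => ⟨a, ha, c, hc, rfl, hzI⟩)
    rcases ((SimpleGraph.fromRel_adj _ _ _).1 hac).2 with ⟨ha, hc⟩ | ⟨hc, ha⟩
    · exact reachable_of_mem a c ha hc
    · exact Sym2.eq_swap ▸ (reachable_of_mem c a hc ha).symm

/-- Disjoint fans centred at `R` form the edges of a topological model with branch set `A`. -/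
lemma mul_card_lt_of_isFan [Finite W] {H : SimpleGraph W} (hH : ¬ H.IsTopologicalMinor G)
    {E : V → Finset V} {I : V → V → Finset V} (hRA : R ⊆ A) (hA : A.Nonempty)
    (hE : ∀ v ∈ R, IsFan G A r v (E v) (I v)) (hk : ∀ v ∈ R, k ≤ #(E v))
    (hI : ∀ v ∈ R, ∀ w ∈ R, v ≠ w → ∀ x ∈ E v, ∀ y ∈ E w, Disjoint (I v x) (I w y)) :
    k * #R < maderBound H * #A := by
  classical
  have card_subtype_of_subset : ∀ B ⊆ A, #{a : A | ↑a ∈ B} = #B := fun B hB => by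
    rw [← card_map (.subtype (· ∈ A))]
    congr 1
    ext z
    simpa using @hB z
  have : Nonempty A := hA.to_subtype
  have E_subset : ∀ v ∈ R, E v ⊆ A := fun v hv x hx => ((hE v hv).isSetPath x hx).end_mem
  calc k * #R = k * #{a : A | ↑a ∈ R} := by rw [card_subtype_of_subset R hRA]
    _ ≤ #((fanGraph A R E).interedges {a | ↑a ∈ R} univ) := by
        refine mul_card_le_card_interedges _ fun a ha => ?_
        have ha := (mem_filter.1 ha).2
        refine (hk a ha).trans ((card_subtype_of_subset _ (E_subset a ha)).symm.le.trans
          (card_le_card fun c hc => ?_))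
        have hc := (mem_filter.1 hc).2
        refine mem_filter.2 ⟨mem_univ c, (fromRel_adj _ _ _).2 ⟨?_, .inl ⟨ha, hc⟩⟩⟩
        rintro rfl
        exact ((hE a ha).isSetPath a hc).end_ne rfl
    _ ≤ #((fanGraph A R E).interedges univ univ) :=
        card_le_card (interedges_mono _ (subset_univ _) subset_rfl)
    _ < maderBound H * #A := by
        simpa using (isTopologicalModel_fanGraph hE hI).card_interedges_lt hH univ_nonempty

/-- `F` is a family of paths of length at most `r` from `v` to `S`, pairwise meeting only in `v`. -/
structure IsPathFamily (G : SimpleGraph V) (S : Set V) (r : ℕ) (v : V)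
    (F : Finset (Σ y : V, G.Path v y)) : Prop where
  length_le : ∀ P ∈ F, (P.2 : G.Walk v P.1).length ≤ r
  end_mem : ∀ P ∈ F, P.1 ∈ S
  eq_of_mem : ∀ P ∈ F, ∀ Q ∈ F, P ≠ Q → ∀ z ∈ (P.2 : G.Walk v P.1).support,
    z ∈ (Q.2 : G.Walk v Q.1).support → z = v

lemma exists_isSetPath_of_isPath [DecidableEq V] {p : G.Walk v y} (hp : p.IsPath)
    (hv : v ∈ A) (hy : y ∈ A) (hyv : y ≠ v) :
    ∃ x I, x ∈ p.support ∧ I ⊆ p.support.toFinset ∧ #I ≤ p.length ∧ IsSetPath G A v x I := by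
  obtain ⟨x, hxA, hx, hx_first⟩ := p.exists_mem_support_forall_mem_support_imp_eq (A.erase v)
    ⟨y, by simp [hy, hyv]⟩
  set q := p.takeUntil x hx
  have hq : q.IsPath := hp.takeUntil hx
  have q_subset : q.support ⊆ p.support := p.support_takeUntil_subset_support hx
  have mem_inner : ∀ z ∈ q.support, z = v ∨ z = x ∨ z ∈ q.support.toFinset \ A := fun z hz => by
    have := hx_first z
    simp only [mem_erase, mem_sdiff, List.mem_toFinset] at this ⊢
    tauto
  refine ⟨x, q.support.toFinset \ A, hx, fun z hz => ?_, ?_,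
    (mem_erase.1 hxA).2, (mem_erase.1 hxA).1, sdiff_disjoint, ⟨q, by simpa using mem_inner⟩, ?_⟩
  · exact List.mem_toFinset.2 (q_subset (List.mem_toFinset.1 (mem_sdiff.1 hz).1))
  · have hqv : q.support.toFinset \ A ⊆ q.support.toFinset.erase v := by grind
    have := (card_le_card hqv).trans_eq (card_erase_of_mem (by simp))
    have := q.support.toFinset_card_le
    have := q.length_support
    have : q.length ≤ p.length := p.length_takeUntil_le_length hx
    omega
  · intro z hz
    obtain ⟨hzq, hzA⟩ := mem_sdiff.1 hz
    rw [List.mem_toFinset] at hzq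
    refine ⟨q.takeUntil z hzq, fun t ht => ?_⟩
    have ht_ne : t ≠ x := by
      rintro rfl
      have hzx : t ≠ z := by rintro rfl; exact hzA (mem_erase.1 hxA).2
      exact Walk.endpoint_notMem_support_takeUntil hq hzq hzx ht
    rcases mem_inner t (q.support_takeUntil_subset_support hzq ht) with h | h | h
    exacts [.inl h, absurd h ht_ne, .inr h]

namespace IsPathFamily

variable {F : Finset (Σ y : V, G.Path v y)}

lemma subset {F' : Finset (Σ y : V, G.Path v y)} (hF : IsPathFamily G S r v F) (h : F' ⊆ F) :
    IsPathFamily G S r v F' where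
  length_le P hP := hF.length_le P (h hP)
  end_mem P hP := hF.end_mem P (h hP)
  eq_of_mem P hP Q hQ := hF.eq_of_mem P (h hP) Q (h hQ)

lemma exists_isFan_of_forall_ne (hF : IsPathFamily G S r v F) (hSA : S ⊆ A) (hv : v ∈ S)
    (hFv : ∀ P ∈ F, P.1 ≠ v) : ∃ E I, IsFan G A r v E I ∧ #E = #F := by
  classical
  have : Nonempty V := ⟨v⟩
  have : Nonempty (Σ y : V, G.Path v y) := ⟨v, Path.nil⟩
  have exists_isSetPath : ∀ P ∈ F, ∃ (x : V) (I : Finset V),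
      x ∈ (P.2 : G.Walk v P.1).support ∧ I ⊆ (P.2 : G.Walk v P.1).support.toFinset ∧
      #I ≤ (P.2 : G.Walk v P.1).length ∧ IsSetPath G A v x I := fun P hP =>
    exists_isSetPath_of_isPath P.2.2 (hSA hv) (hSA (hF.end_mem P hP)) (hFv P hP)
  choose! x I hx hI hI_card hxI using exists_isSetPath
  have x_inj : Set.InjOn x F := fun P hP Q hQ hPQ => by
    by_contra hne
    exact (hxI P hP).end_ne (hF.eq_of_mem P hP Q hQ hne _ (hx P hP) (hPQ ▸ hx Q hQ))
  have I_inv : ∀ P ∈ F, (I ∘ Function.invFunOn x F) (x P) = I P := fun P hP =>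
    congrArg I (x_inj.leftInvOn_invFunOn hP)
  refine ⟨F.image x, I ∘ Function.invFunOn x F, ⟨?_, ?_, ?_⟩, card_image_of_injOn x_inj⟩
  · exact forall_mem_image.2 fun P hP => (I_inv P hP).symm ▸ hxI P hP
  · exact forall_mem_image.2 fun P hP =>
      (I_inv P hP).symm ▸ (hI_card P hP).trans (hF.length_le P hP)
  · rw [coe_image]
    rintro _ ⟨P, hP, rfl⟩ _ ⟨Q, hQ, rfl⟩ hne
    rw [Function.onFun, I_inv P hP, I_inv Q hQ]
    refine Finset.disjoint_left.2 fun z hzP hzQ => ?_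
    have hzv : z = v := hF.eq_of_mem P hP Q hQ (fun h => hne (congrArg x h)) z
      (List.mem_toFinset.1 (hI P hP hzP)) (List.mem_toFinset.1 (hI Q hQ hzQ))
    exact Finset.disjoint_left.1 (hxI P hP).disjoint hzP (hzv ▸ hSA hv)

/-- Only the path of length `0` is lost in passing from a path family to a fan. -/
lemma exists_isFan (hF : IsPathFamily G S r v F) (hSA : S ⊆ A) (hv : v ∈ S) :
    ∃ E I, IsFan G A r v E I ∧ #F ≤ #E + 1 := by
  classical
  have hF_ne : IsPathFamily G S r v {P ∈ F | ¬ P.1 = v} := hF.subset (filter_subset _ F)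
  obtain ⟨E, I, hEI, hE⟩ :=
    hF_ne.exists_isFan_of_forall_ne hSA hv fun P hP => (mem_filter.1 hP).2
  have trivial_subset : {P ∈ F | P.1 = v} ⊆ {⟨v, Path.nil⟩} := by
    rintro ⟨y, P⟩ hP
    obtain ⟨-, rfl : y = v⟩ := mem_filter.1 hP
    rw [P.loop_eq, mem_singleton]
  have card_trivial := card_le_card trivial_subset
  rw [card_singleton] at card_trivial
  have card_add := card_filter_add_card_filter_not (s := F) (fun P => P.1 = v)
  exact ⟨E, I, hEI, by omega⟩

end IsPathFamily

end Fan

section Admissibility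

open SimpleGraph Finset

variable {V W : Type*} {G : SimpleGraph V} {H : SimpleGraph W} {S : Finset V} {r : ℕ} {v : V}

/-- If `H` is not a topological minor of a finite graph, then the `r`-admissibility of that graph is
at most `admCoeff H * r`. -/
noncomputable def admCoeff (H : SimpleGraph W) : ℕ :=
  maderBound H ^ 2 * (1 + maderBound H)

lemma one_le_admCoeff [Finite W] (H : SimpleGraph W) : 1 ≤ admCoeff H :=
  Nat.mul_pos (pow_pos (maderBound_pos H) 2) (by omega)

/-- `A` consists of `S` and the inner vertices of a maximal model with branch set `S` and short
edges, and `R` is an independent set of the modelled graph: if `I` and `J` met, then they would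
connect `v` and `w`, and the edge `vw` could be added to the model. -/
lemma exists_forall_isSetPath_disjoint [Finite W] (hH : ¬ H.IsTopologicalMinor G)
    (hS : S.Nonempty) (r : ℕ) :
    ∃ A R : Finset V, S ⊆ A ∧ R ⊆ S ∧ #A ≤ #S + maderBound H * #S * r ∧
      #S ≤ maderBound H * #R ∧ ∀ v ∈ R, ∀ w ∈ R, v ≠ w → ∀ x y : V, ∀ I J : Finset V,
        IsSetPath G A v x I → IsSetPath G A w y J → #I ≤ r → #J ≤ r → Disjoint I J := by
  classical
  obtain ⟨K, M, hKM, hM, K_adj⟩ := exists_saturated_isTopologicalModel G S (2 * r)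
  have : Nonempty S := hS.to_subtype
  obtain ⟨R, -, hR, card_R⟩ := exists_isIndepSet_of_card_interedges_lt (K := K) univ
    fun T _ hT => hKM.card_interedges_lt hH hT
  have card_edgeFinset : 2 * #K.edgeFinset ≤ maderBound H * #S := by
    rw [← card_interedges_univ]
    simpa using (hKM.card_interedges_lt hH univ_nonempty).le
  refine ⟨S ∪ K.edgeFinset.biUnion M, R.map (.subtype _), subset_union_left, map_subtype_subset R,
    ?_, by simpa using card_R, ?_⟩
  · have card_inner : #(K.edgeFinset.biUnion M) ≤ #K.edgeFinset * (2 * r) :=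
      card_biUnion_le_card_mul _ _ _ fun e _ => hM e
    have := card_union_le S (K.edgeFinset.biUnion M)
    have := Nat.mul_le_mul_right r card_edgeFinset
    nlinarith
  · simp only [mem_map, Function.Embedding.coe_subtype, forall_exists_index, and_imp]
    rintro _ v hv rfl _ w hw rfl hvw x y I J hI hJ hIr hJr
    by_contra hIJ
    have hvw : v ≠ w := fun h => hvw (congrArg _ h)
    refine hR hv hw hvw (K_adj v w (I ∪ J) hvw ?_ ?_ ?_ (hI.reachableWithin_union hJ hIJ))
    · have := card_union_le I J
      omega
    · exact (hI.disjoint.sup_left hJ.disjoint).mono_right subset_union_left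
    · refine fun e he => (Disjoint.mono_right ?_ (hI.disjoint.sup_left hJ.disjoint)).symm
      exact (subset_biUnion_of_mem M (mem_edgeFinset.2 he)).trans subset_union_right

lemma exists_card_pathFamily_le [Finite W] (hH : ¬ H.IsTopologicalMinor G) (hr : 1 ≤ r)
    (hS : S.Nonempty) : ∃ v ∈ S, ∀ F, IsPathFamily G S r v F → #F ≤ admCoeff H * r := by
  by_contra! hF
  obtain ⟨A, R, hSA, hRS, card_A, card_S, hI⟩ := exists_forall_isSetPath_disjoint hH hS r
  have exists_fan : ∀ v ∈ R, ∃ (E : Finset V) (I : V → Finset V),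
      IsFan G A r v E I ∧ admCoeff H * r ≤ #E := fun v hv => by
    obtain ⟨F, hF, card_F⟩ := hF v (hRS hv)
    obtain ⟨E, I, hEI, hE⟩ := hF.exists_isFan hSA (hRS hv)
    exact ⟨E, I, hEI, by omega⟩
  choose! E I hEI hE using exists_fan
  have card_lt := mul_card_lt_of_isFan hH (hRS.trans hSA) (hS.mono hSA) hEI hE
    fun v hv w hw hvw x hx y hy => hI v hv w hw hvw x y _ _ ((hEI v hv).isSetPath x hx)
      ((hEI w hw).isSetPath y hy) ((hEI v hv).card_le x hx) ((hEI w hw).card_le y hy)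
  set D := maderBound H
  refine lt_irrefl (admCoeff H * r * #S) ?_
  calc admCoeff H * r * #S ≤ admCoeff H * r * (D * #R) := by gcongr
    _ = D * (admCoeff H * r * #R) := by ring
    _ < D * (D * #A) := Nat.mul_lt_mul_of_pos_left card_lt (maderBound_pos H)
    _ ≤ D * (D * (#S * r + D * #S * r)) := by
        gcongr
        exact card_A.trans (Nat.add_le_add_right (Nat.le_mul_of_pos_right _ hr) _)
    _ = admCoeff H * r * #S := by rw [admCoeff]; ring

lemma exists_injOn_of_forall_exists_mem {Q : Finset V → V → Prop}
    (hQ : ∀ S : Finset V, S.Nonempty → ∃ v ∈ S, Q S v) (S : Finset V) :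
    ∃ L : V → ℕ, Set.InjOn L S ∧ (∀ v ∈ S, L v < #S) ∧ ∀ v ∈ S, Q {w ∈ S | L w ≤ L v} v := by
  classical
  induction S using Finset.strongInduction with
  | H S ih =>
  rcases S.eq_empty_or_nonempty with rfl | hS
  · exact ⟨fun _ => 0, by simp⟩
  obtain ⟨v, hv, hvQ⟩ := hQ S hS
  obtain ⟨L, L_inj, L_lt, hL⟩ := ih (S.erase v) (erase_ssubset hv)
  have card_erase := card_erase_add_one hv
  set L' := Function.update L v #(S.erase v)
  have L'_self : L' v = #(S.erase v) := Function.update_self ..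
  have L'_of_ne : ∀ w ≠ v, L' w = L w := fun w hw => Function.update_of_ne hw ..
  refine ⟨L', ?_, ?_, fun w hw => ?_⟩
  · rw [← insert_erase hv, coe_insert, Set.injOn_insert (by simp)]
    refine ⟨L_inj.congr fun w hw => (L'_of_ne w (ne_of_mem_erase hw)).symm, ?_⟩
    rintro ⟨w, hw, h⟩
    rw [L'_self, L'_of_ne w (ne_of_mem_erase hw)] at h
    exact (L_lt w hw).ne h
  · grind
  · by_cases hwv : w = v
    · subst hwv
      convert hvQ using 1
      grind
    · convert hL w (mem_erase.2 ⟨hwv, hw⟩) using 1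
      grind

lemma exists_embedding_of_forall_exists_mem [Finite V] {Q : Set V → V → Prop}
    (hQ : ∀ S : Finset V, S.Nonempty → ∃ v ∈ S, Q S v) :
    ∃ L : V ↪ ℕ, ∀ v, Q {w | L w ≤ L v} v := by
  have := Fintype.ofFinite V
  obtain ⟨L, L_inj, -, hL⟩ := exists_injOn_of_forall_exists_mem (Q := fun S => Q S) hQ univ
  exact ⟨⟨L, Set.injOn_univ.1 (by simpa using L_inj)⟩, fun v => by simpa using hL v (mem_univ v)⟩

lemma isPathFamily_of_isAdmFamily {L : V ↪ ℕ} {F : Finset (Σ y : V, G.Path v y)}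
    (hF : G.IsAdmFamily L r v F) : IsPathFamily G {w | L w ≤ L v} r v F where
  length_le P hP := (hF.1 P hP).1
  end_mem P hP := (hF.1 P hP).2
  eq_of_mem P hP Q hQ hPQ _ hzP hzQ := (hF.2 P hP Q hQ hPQ).subset (And.intro hzP hzQ)

theorem adm_le_of_not_isTopologicalMinor [Finite V] [Finite W] (hH : ¬ H.IsTopologicalMinor G)
    (hr : 1 ≤ r) : G.adm r ≤ admCoeff H * r := by
  obtain ⟨L, hL⟩ := exists_embedding_of_forall_exists_mem
    (Q := fun S v => ∀ F, IsPathFamily G S r v F → #F ≤ admCoeff H * r)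
    fun S hS => exists_card_pathFamily_le hH hr hS
  refine (ciInf_le (OrderBot.bddBelow _) L).trans (ciSup_le' fun x => csSup_le' ?_)
  rintro _ ⟨F, hF, rfl⟩
  exact hL x F (isPathFamily_of_isAdmFamily hF)

end Admissibility

section SearchTree

open SimpleGraph Finset

variable {V : Type*} {G : SimpleGraph V} {B U : Set V} {x y z u : V} {d : V → ℕ} {par : V → V}
  {T : Finset V} {i j k n s : ℕ}

/-- There is a walk of length `n` from `x` to `y` all of whose vertices, except possibly the last
one, belong to `B`. -/
def ReachableThrough (G : SimpleGraph V) (B : Set V) (x : V) : ℕ → V → Prop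
  | 0, y => y = x
  | n + 1, y => ∃ z ∈ B, ReachableThrough G B x n z ∧ G.Adj z y

/-- `par` maps every non-root vertex of a tree in `G` with root `x` and vertex set `U` to its
parent, `d` is the depth, and all vertices of the tree that are not leaves belong to `B`. -/
structure IsRootedTree (G : SimpleGraph V) (B : Set V) (x : V) (U : Set V) (d : V → ℕ)
    (par : V → V) : Prop where
  eq_root : ∀ y ∈ U, d y = 0 → y = x
  par_mem : ∀ y ∈ U, d y ≠ 0 → par y ∈ U
  depth_par : ∀ y ∈ U, d y ≠ 0 → d (par y) + 1 = d y
  par_mem_inner : ∀ y ∈ U, d y ≠ 0 → par y ∈ B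
  adj_par : ∀ y ∈ U, d y ≠ 0 → G.Adj (par y) y

lemma exists_isRootedTree_depth_le (G : SimpleGraph V) (B : Set V) (x : V) :
    ∃ d par, IsRootedTree G B x {y | ∃ n, ReachableThrough G B x n y} d par ∧
      ∀ n y, ReachableThrough G B x n y → d y ≤ n := by
  have : Nonempty V := ⟨x⟩
  let d : V → ℕ := fun y => sInf {n | ReachableThrough G B x n y}
  have d_le : ∀ n y, ReachableThrough G B x n y → d y ≤ n := fun n y h => Nat.sInf_le h
  have reachable_d : ∀ y, (∃ n, ReachableThrough G B x n y) → ReachableThrough G B x (d y) y :=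
    fun y h => Nat.sInf_mem (s := {n | ReachableThrough G B x n y}) h
  have exists_par : ∀ y, (∃ n, ReachableThrough G B x n y) → d y ≠ 0 →
      ∃ z ∈ B, (∃ n, ReachableThrough G B x n z) ∧ d z + 1 = d y ∧ G.Adj z y := by
    intro y hy hdy
    obtain ⟨m, hm⟩ := Nat.exists_eq_succ_of_ne_zero hdy
    have hy_succ := reachable_d y hy
    rw [hm] at hy_succ
    obtain ⟨z, hzB, hz, hzy⟩ := hy_succ
    have := d_le m z hz
    have := d_le (d z + 1) y ⟨z, hzB, reachable_d z ⟨m, hz⟩, hzy⟩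
    exact ⟨z, hzB, ⟨m, hz⟩, by omega, hzy⟩
  choose! par par_mem_inner par_mem depth_par adj_par using exists_par
  refine ⟨d, par, ⟨fun y hy hdy => ?_, par_mem, depth_par, par_mem_inner, adj_par⟩, d_le⟩
  have := reachable_d y hy
  rwa [hdy] at this

/-- The ancestor of `y` at depth `j` in a tree with depth `d` and parents `par`, or `y` itself if
the depth of `y` is less than `j`. -/
def ancestor (d : V → ℕ) (par : V → V) (j : ℕ) (y : V) : V :=
  par^[d y - j] y

lemma ancestor_of_le (h : d y ≤ j) : ancestor d par j y = y := by
  rw [ancestor, Nat.sub_eq_zero_of_le h, Function.iterate_zero, id]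

lemma ancestor_eq_par (h : j < d y) :
    ancestor d par j y = par (ancestor d par (j + 1) y) := by
  rw [ancestor, ancestor, ← Function.iterate_succ_apply' par]
  congr 2
  omega

namespace IsRootedTree

variable (hd : IsRootedTree G B x U d par)

include hd

lemma ancestor_mem_and_depth_eq (hy : y ∈ U) (hj : j ≤ d y) :
    ancestor d par j y ∈ U ∧ d (ancestor d par j y) = j := by
  induction hj using Nat.decreasingInduction with
  | self => rw [ancestor_of_le le_rfl]; exact ⟨hy, rfl⟩
  | of_succ j hj ih =>
    have depth_ne : d (ancestor d par (j + 1) y) ≠ 0 := by omega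
    have := hd.depth_par _ ih.1 depth_ne
    rw [ancestor_eq_par hj]
    exact ⟨hd.par_mem _ ih.1 depth_ne, by omega⟩

lemma depth_ancestor (hy : y ∈ U) (hj : j ≤ d y) : d (ancestor d par j y) = j :=
  (hd.ancestor_mem_and_depth_eq hy hj).2

lemma ancestor_mem_inner (hy : y ∈ U) (hj : j < d y) : ancestor d par j y ∈ B := by
  obtain ⟨hmem, hdepth⟩ := hd.ancestor_mem_and_depth_eq (j := j + 1) hy hj
  rw [ancestor_eq_par hj]
  exact hd.par_mem_inner _ hmem (by omega)

lemma adj_ancestor (hy : y ∈ U) (hj : j < d y) :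
    G.Adj (ancestor d par j y) (ancestor d par (j + 1) y) := by
  obtain ⟨hmem, hdepth⟩ := hd.ancestor_mem_and_depth_eq (j := j + 1) hy hj
  rw [ancestor_eq_par hj]
  exact hd.adj_par _ hmem (by omega)

lemma ancestor_zero (hy : y ∈ U) : ancestor d par 0 y = x :=
  hd.eq_root _ (hd.ancestor_mem_and_depth_eq hy (Nat.zero_le _)).1
    (hd.depth_ancestor hy (Nat.zero_le _))

lemma ancestor_ancestor (hy : y ∈ U) (hji : j ≤ i) (hi : i ≤ d y) :
    ancestor d par j (ancestor d par i y) = ancestor d par j y := by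
  rw [ancestor, hd.depth_ancestor hy hi, ancestor, ancestor, ← Function.iterate_add_apply]
  congr 1
  omega

lemma exists_walk_ancestor (hy : y ∈ U) (hj : j ≤ d y) :
    ∃ p : G.Walk (ancestor d par j y) y, p.length = d y - j ∧
      ∀ z ∈ p.support, ∃ i, j ≤ i ∧ i ≤ d y ∧ z = ancestor d par i y := by
  induction hj using Nat.decreasingInduction with
  | self =>
    refine ⟨Walk.nil.copy (ancestor_of_le le_rfl).symm rfl, by simp, fun z hz => ?_⟩
    exact ⟨d y, le_rfl, le_rfl, by simpa [ancestor_of_le le_rfl] using hz⟩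
  | of_succ j hj ih =>
    obtain ⟨p, hp, hpz⟩ := ih
    refine ⟨p.cons (hd.adj_ancestor hy hj), by rw [Walk.length_cons]; omega, fun z hz => ?_⟩
    rw [Walk.support_cons, List.mem_cons] at hz
    rcases hz with rfl | hz
    · exact ⟨j, le_rfl, hj.le, rfl⟩
    · obtain ⟨i, hji, hi, rfl⟩ := hpz z hz
      exact ⟨i, by omega, hi, rfl⟩

/-- The paths to two descendants of `u` that belong to different children of `u` meet only
in `u`. -/
lemma exists_walk_of_ancestor_eq (hy : y ∈ U) (hj : j < d y) (hu : ancestor d par j y = u) :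
    ∃ p : G.Walk u y, p.length ≤ d y ∧
      ∀ z ∈ p.support, z = u ∨ ancestor d par (j + 1) z = ancestor d par (j + 1) y := by
  subst hu
  obtain ⟨p, hp, hpz⟩ := hd.exists_walk_ancestor hy hj.le
  refine ⟨p, by omega, fun z hz => ?_⟩
  obtain ⟨i, hji, hi, rfl⟩ := hpz z hz
  rcases hji.eq_or_lt with rfl | hji
  · exact .inl rfl
  · exact .inr (hd.ancestor_ancestor hy hji hi)

end IsRootedTree

lemma exists_isPathFamily_of_walks {ι : Type*} [Fintype ι] {S : Set V} {t : ι → V}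
    (p : ∀ i, G.Walk u (t i)) (hlen : ∀ i, (p i).length ≤ s) (hS : ∀ i, t i ∈ S)
    (hu : ∀ i, t i ≠ u)
    (hp : ∀ i j, i ≠ j → ∀ z ∈ (p i).support, z ∈ (p j).support → z = u) :
    ∃ F, IsPathFamily G S s u F ∧ #F = Fintype.card ι := by
  classical
  let path : ι → Σ y : V, G.Path u y := fun i => ⟨t i, (p i).toPath⟩
  have eq_of_mem : ∀ i j, i ≠ j → ∀ z ∈ ((p i).toPath : G.Walk u (t i)).support,
      z ∈ ((p j).toPath : G.Walk u (t j)).support → z = u := fun i j hij z hi hj =>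
    hp i j hij z ((p i).support_toPath_subset_support hi) ((p j).support_toPath_subset_support hj)
  have path_inj : Function.Injective path := fun i j hij => by
    by_contra hne
    have hmem : t i ∈ ((p j).toPath : G.Walk u (t j)).support := by
      rw [show t i = t j from congrArg Sigma.fst hij]
      exact Walk.end_mem_support _
    exact hu i (eq_of_mem i j hne (t i) (Walk.end_mem_support _) hmem)
  refine ⟨univ.map ⟨path, path_inj⟩, ⟨?_, ?_, ?_⟩, card_map _⟩
  · simpa [path, Walk.toPath] using fun i => (p i).length_bypass_le_length.trans (hlen i)
  · simpa [path] using hS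
  · simp only [mem_map, mem_univ, true_and, Function.Embedding.coeFn_mk]
    rintro _ ⟨i, rfl⟩ _ ⟨j, rfl⟩ hij
    exact eq_of_mem i j fun h => hij (congrArg path h)

lemma card_image_le_pow {α β : Type*} [DecidableEq β] {T : Finset α} {a : ℕ → α → β}
    (h0 : #(T.image (a 0)) ≤ 1)
    (hsucc : ∀ j b, #({t ∈ T | a j t = b}.image (a (j + 1))) ≤ k) (n : ℕ) :
    #(T.image (a n)) ≤ k ^ n := by
  induction n with
  | zero => simpa using h0
  | succ n ih =>
    have hsub : T.image (a (n + 1)) ⊆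
        (T.image (a n)).biUnion fun b => {t ∈ T | a n t = b}.image (a (n + 1)) := by
      refine image_subset_iff.2 fun t ht => mem_biUnion.2 ⟨a n t, mem_image_of_mem _ ht, ?_⟩
      exact mem_image_of_mem _ (mem_filter.2 ⟨ht, rfl⟩)
    calc #(T.image (a (n + 1))) ≤ #(T.image (a n)) * k :=
          (card_le_card hsub).trans (card_biUnion_le_card_mul _ _ _ fun b _ => hsucc n b)
      _ ≤ k ^ (n + 1) := Nat.mul_le_mul_right k ih

lemma IsRootedTree.card_image_ancestor_le [DecidableEq V] (hd : IsRootedTree G B x U d par)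
    (hk : 1 ≤ k) (hkB : ∀ u ∈ B, ∀ F, IsPathFamily G T s u F → #F ≤ k) (hTU : ↑T ⊆ U)
    (hTB : ∀ t ∈ T, t ∉ B) (hTs : ∀ t ∈ T, d t ≤ s) (j : ℕ) (u : V) :
    #({t ∈ T | ancestor d par j t = u}.image (ancestor d par (j + 1))) ≤ k := by
  by_cases hu : u ∈ B
  · have lt_depth : ∀ t ∈ T, ancestor d par j t = u → j < d t := by
      rintro t ht rfl
      by_contra! h
      exact hTB t ht (by rwa [ancestor_of_le h] at hu)
    set C := {t ∈ T | ancestor d par j t = u}.image (ancestor d par (j + 1))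
    have exists_walk : ∀ c : C, ∃ t ∈ T, ∃ p : G.Walk u t, p.length ≤ s ∧
        ∀ z ∈ p.support, z = u ∨ ancestor d par (j + 1) z = c := by
      rintro ⟨c, hc⟩
      obtain ⟨t, ht, rfl⟩ := mem_image.1 hc
      obtain ⟨htT, htu⟩ := mem_filter.1 ht
      obtain ⟨p, hp, hpz⟩ := hd.exists_walk_of_ancestor_eq (hTU htT) (lt_depth t htT htu) htu
      exact ⟨t, htT, p, hp.trans (hTs t htT), hpz⟩
    choose t ht p hp hpz using exists_walk
    obtain ⟨F, hF, card_F⟩ := exists_isPathFamily_of_walks p hp ht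
      (fun c h => hTB _ (ht c) (h ▸ hu)) fun c c' hcc' z hz hz' => by
        by_contra hzu
        exact hcc' (Subtype.ext (((hpz c z hz).resolve_left hzu).symm.trans
          ((hpz c' z hz').resolve_left hzu)))
    rw [← Fintype.card_coe C, ← card_F]
    exact hkB u hu F hF
  · refine (card_le_one.2 ?_).trans hk
    have eq_self : ∀ t ∈ T, ancestor d par j t = u → ancestor d par (j + 1) t = u := by
      rintro t ht rfl
      have h : d t ≤ j := by
        by_contra! h
        exact hu (hd.ancestor_mem_inner (hTU ht) h)
      rw [ancestor_of_le h, ancestor_of_le (h.trans j.le_succ)]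
    grind

theorem card_le_pow_of_reachableThrough (hk : 1 ≤ k)
    (hkB : ∀ u ∈ B, ∀ F, IsPathFamily G T s u F → #F ≤ k) (hTB : ∀ t ∈ T, t ∉ B)
    (hT : ∀ t ∈ T, ReachableThrough G B x s t) : #T ≤ k ^ s := by
  classical
  obtain ⟨d, par, hd, d_le⟩ := exists_isRootedTree_depth_le G B x
  have hTU : ↑T ⊆ {y | ∃ n, ReachableThrough G B x n y} := fun t ht => ⟨s, hT t ht⟩
  have hTs : ∀ t ∈ T, d t ≤ s := fun t ht => d_le s t (hT t ht)
  have image_zero : #(T.image (ancestor d par 0)) ≤ 1 :=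
    card_le_card (image_subset_iff.2 fun t ht =>
      mem_singleton.2 (hd.ancestor_zero (hTU ht))) |>.trans_eq (card_singleton x)
  have image_self : T.image (ancestor d par s) = T :=
    (image_congr fun t ht => ancestor_of_le (hTs t ht)).trans image_id
  rw [← image_self]
  exact card_image_le_pow image_zero (hd.card_image_ancestor_le hk hkB hTU hTB hTs) s

end SearchTree

section WeakReachability

open SimpleGraph Finset

variable {V : Type*} {G : SimpleGraph V} {L : V ↪ ℕ} {B : Set V} {k n r : ℕ} {x y z : V}

lemma mem_wReach_iff_exists_walk :
    y ∈ G.wReach L r x ↔ ∃ p : G.Walk x y, p.length ≤ r ∧ ∀ w ∈ p.support, L y ≤ L w := by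
  classical
  refine ⟨fun ⟨p, _, hp, hL⟩ => ⟨p, hp, hL⟩, fun ⟨p, hp, hL⟩ => ⟨p.bypass, p.bypass_isPath, ?_, ?_⟩⟩
  · exact p.length_bypass_le_length.trans hp
  · exact fun w hw => hL w (p.support_bypass_subset_support hw)

lemma exists_reachableThrough_of_notMem (p : G.Walk z y) (hz : ReachableThrough G B x n z)
    (hzB : z ∈ B) (hy : y ∉ B) :
    ∃ s t, n < s ∧ t ∉ B ∧ ReachableThrough G B x s t ∧
      ∃ q : G.Walk t y, s + q.length = n + p.length ∧ q.support ⊆ p.support := by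
  induction p generalizing n with
  | nil => exact absurd hzB hy
  | @cons a c y hac p ih =>
    have hc : ReachableThrough G B x (n + 1) c := ⟨a, hzB, hz, hac⟩
    by_cases hcB : c ∈ B
    · obtain ⟨s, t, hs, ht, hst, q, hq, hqp⟩ := ih hc hcB hy
      exact ⟨s, t, by omega, ht, hst, q, by rw [Walk.length_cons]; omega,
        fun w hw => List.mem_cons_of_mem a (hqp hw)⟩
    · exact ⟨n + 1, c, by omega, hcB, hc, p, by rw [Walk.length_cons]; omega,
        List.subset_cons_self _ _⟩

/-- Split a walk at its first vertex below `x`. -/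
lemma wReach_subset (G : SimpleGraph V) (L : V ↪ ℕ) (n : ℕ) (x : V) :
    G.wReach L n x ⊆ insert x (⋃ i ∈ range n,
      ⋃ t ∈ {t | L t < L x ∧ ReachableThrough G {w | L x ≤ L w} x (n - i) t}, G.wReach L i t) := by
  intro y hy
  obtain ⟨p, hp, hL⟩ := mem_wReach_iff_exists_walk.1 hy
  rcases (hL x p.start_mem_support).eq_or_lt with hyx | hyx
  · exact .inl (L.injective hyx)
  obtain ⟨s, t, hs, ht, hst, q, hq, hqp⟩ := exists_reachableThrough_of_notMem (n := 0) (x := x)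
    (B := {w | L x ≤ L w}) p rfl (le_refl (L x)) (not_le.2 hyx)
  simp only [Set.mem_insert_iff, Set.mem_iUnion]
  have hsn : n - (n - s) = s := by omega
  refine .inr ⟨n - s, mem_range.2 (by omega), t, ⟨not_le.1 ht, hsn.symm ▸ hst⟩, ?_⟩
  exact mem_wReach_iff_exists_walk.2 ⟨q, by omega, fun w hw => hL w (hqp hw)⟩

lemma isAdmFamily_of_isPathFamily {S : Set V} {F : Finset (Σ y : V, G.Path x y)}
    (hF : IsPathFamily G S n x F) (hnr : n ≤ r) (hS : ∀ t ∈ S, L t ≤ L x) :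
    G.IsAdmFamily L r x F := by
  refine ⟨fun P hP => ⟨(hF.length_le P hP).trans hnr, hS _ (hF.end_mem P hP)⟩,
    fun P hP Q hQ hPQ => Set.Subset.antisymm ?_ ?_⟩
  · exact fun z hz => hF.eq_of_mem P hP Q hQ hPQ z hz.1 hz.2
  · rintro _ rfl
    exact ⟨Walk.start_mem_support _, Walk.start_mem_support _⟩

lemma one_le_of_forall_isAdmFamily_card_le (hk : ∀ F, G.IsAdmFamily L r x F → #F ≤ k) : 1 ≤ k := by
  refine hk {⟨x, Path.nil⟩} ⟨by simp, fun P hP Q hQ hPQ => absurd ?_ hPQ⟩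
  rw [mem_singleton.1 hP, mem_singleton.1 hQ]

theorem ncard_wReach_le [Finite V] (hk : ∀ x F, G.IsAdmFamily L r x F → #F ≤ k) (hn : n ≤ r)
    (x : V) : (G.wReach L n x).ncard ≤ (2 * k) ^ n := by
  classical
  have := Fintype.ofFinite V
  induction n using Nat.strong_induction_on generalizing x with
  | _ n ih =>
  have one_le : 1 ≤ k := one_le_of_forall_isAdmFamily_card_le (hk x)
  let T (i : ℕ) : Finset V :=
    {t | L t < L x ∧ ReachableThrough G {w | L x ≤ L w} x (n - i) t}
  have mem_T : ∀ i, ∀ t ∈ T i, L t < L x ∧ ReachableThrough G {w | L x ≤ L w} x (n - i) t :=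
    fun i t ht => (mem_filter.1 ht).2
  have card_T : ∀ i, #(T i) ≤ k ^ (n - i) := fun i =>
    card_le_pow_of_reachableThrough one_le
      (fun u hu F hF => hk u F (isAdmFamily_of_isPathFamily hF (by omega)
        fun t ht => (mem_T i t ht).1.le.trans hu))
      (fun t ht => not_le.2 (mem_T i t ht).1) (fun t ht => (mem_T i t ht).2)
  calc (G.wReach L n x).ncard
      ≤ (insert x (⋃ i ∈ range n, ⋃ t ∈ T i, G.wReach L i t)).ncard :=
        Set.ncard_le_ncard ((wReach_subset G L n x).trans (by simp [T])) (Set.toFinite _)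
    _ ≤ ∑ i ∈ range n, (⋃ t ∈ T i, G.wReach L i t).ncard + 1 :=
        (Set.ncard_insert_le _ _).trans (Nat.add_le_add_right (set_ncard_biUnion_le _ _) 1)
    _ ≤ ∑ i ∈ range n, k ^ (n - i) * (k + k) ^ i + 1 := by
        gcongr with i hi
        have hi := mem_range.1 hi
        refine (set_ncard_biUnion_le _ _).trans ((sum_le_card_nsmul _ _ ((k + k) ^ i) ?_).trans ?_)
        · exact fun t _ => two_mul k ▸ ih i hi (by omega) t
        · exact Nat.mul_le_mul_right _ (card_T i)
    _ ≤ (∑ i ∈ range n, (k + k) ^ i * k ^ (n - 1 - i)) * k + k ^ n := by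
        rw [sum_mul]
        refine Nat.add_le_add (sum_le_sum fun i hi => le_of_eq ?_) (Nat.one_le_pow _ _ one_le)
        have : n - i = n - 1 - i + 1 := by have := mem_range.1 hi; omega
        rw [this, pow_succ]
        ring
    _ = (2 * k) ^ n := by rw [geom_sum₂_mul_add, two_mul]

lemma exists_forall_isAdmFamily_card_le_adm [Finite V] (G : SimpleGraph V) (r : ℕ) :
    ∃ L : V ↪ ℕ, ∀ x F, G.IsAdmFamily L r x F → #F ≤ G.adm r := by
  have : Nonempty (V ↪ ℕ) := ⟨(Finite.equivFin V).toEmbedding.trans Fin.valEmbedding⟩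
  obtain ⟨L, hL⟩ := Nat.sInf_mem (Set.range_nonempty fun L : V ↪ ℕ => ⨆ x, G.admAt L r x)
  refine ⟨L, fun x F hF => ?_⟩
  calc #F ≤ G.admAt L r x := le_csSup ⟨Nat.card V, by
        rintro _ ⟨F, hF, rfl⟩
        exact hF.card_le⟩ ⟨F, hF, rfl⟩
    _ ≤ ⨆ x, G.admAt L r x := le_ciSup (Set.finite_range _).bddAbove x
    _ = G.adm r := hL

theorem wcol_le_pow [Finite V] (G : SimpleGraph V) (r : ℕ) : G.wcol r ≤ (2 * G.adm r) ^ r := by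
  obtain ⟨L, hL⟩ := exists_forall_isAdmFamily_card_le_adm G r
  exact (ciInf_le (OrderBot.bddBelow _) L).trans (ciSup_le' fun x => ncard_wReach_le hL le_rfl x)

end WeakReachability

lemma exists_mul_pow_self_le_rpow {B ε : ℝ} (hB : 1 ≤ B) (hε : 0 < ε) :
    ∃ c : ℝ, ∀ r : ℕ, 1 ≤ r → (B * r) ^ r ≤ c * (r : ℝ) ^ ((1 + ε) * (r : ℝ)) := by
  obtain ⟨N, hN⟩ := Filter.eventually_atTop.1
    (((tendsto_rpow_atTop hε).comp tendsto_natCast_atTop_atTop).eventually_ge_atTop B)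
  refine ⟨B ^ N, fun r hr => ?_⟩
  have one_le : (1 : ℝ) ≤ r := by exact_mod_cast hr
  have pos : (0 : ℝ) < r := by linarith
  have pow_le : B ^ r ≤ B ^ N * ((r : ℝ) ^ ε) ^ r := by
    rcases le_total N r with h | h
    · calc B ^ r ≤ ((r : ℝ) ^ ε) ^ r := pow_le_pow_left₀ (by linarith) (hN r h) r
        _ ≤ B ^ N * ((r : ℝ) ^ ε) ^ r :=
            le_mul_of_one_le_left (by positivity) (one_le_pow₀ hB)
    · calc B ^ r ≤ B ^ N := pow_le_pow_right₀ hB h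
        _ ≤ B ^ N * ((r : ℝ) ^ ε) ^ r :=
            le_mul_of_one_le_right (by positivity) (one_le_pow₀ (Real.one_le_rpow one_le hε.le))
  calc (B * r) ^ r = B ^ r * (r : ℝ) ^ r := mul_pow ..
    _ ≤ B ^ N * ((r : ℝ) ^ ε) ^ r * (r : ℝ) ^ r := by gcongr
    _ = B ^ N * (r : ℝ) ^ ((1 + ε) * (r : ℝ)) := by
        rw [add_mul, one_mul, Real.rpow_add pos, Real.rpow_natCast, Real.rpow_mul pos.le,
          Real.rpow_natCast]
        ring

theorem mainTheorem2 {W : Type v} [Finite W] (H : SimpleGraph W)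
    (C : ∀ V : Type u, SimpleGraph V → Prop)
    (hfin : ∀ (V : Type u) (G : SimpleGraph V), C V G → Finite V)
    (hC : ∀ (V : Type u) (G : SimpleGraph V), C V G → ¬ H.IsTopologicalMinor G) :
    (∃ c : ℝ, ∀ (V : Type u) (G : SimpleGraph V), C V G →
      ∀ r : ℕ, 1 ≤ r → (G.adm r : ℝ) ≤ c * r) ∧
    (∀ ε : ℝ, 0 < ε → ∃ c : ℝ, ∀ (V : Type u) (G : SimpleGraph V), C V G →
      ∀ r : ℕ, 1 ≤ r → (G.wcol r : ℝ) ≤ c * (r : ℝ) ^ ((1 + ε) * (r : ℝ))) := by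
  have adm_le : ∀ (V : Type u) (G : SimpleGraph V), C V G → ∀ r : ℕ, 1 ≤ r →
      (G.adm r : ℝ) ≤ admCoeff H * r := fun V G hG r hr => by
    have := hfin V G hG
    exact_mod_cast adm_le_of_not_isTopologicalMinor (hC V G hG) hr
  refine ⟨⟨admCoeff H, adm_le⟩, fun ε hε => ?_⟩
  have one_le : (1 : ℝ) ≤ 2 * admCoeff H := by
    have := one_le_admCoeff H
    exact_mod_cast (by omega : 1 ≤ 2 * admCoeff H)
  obtain ⟨c, hc⟩ := exists_mul_pow_self_le_rpow one_le hε
  refine ⟨c, fun V G hG r hr => ?_⟩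
  have := hfin V G hG
  calc (G.wcol r : ℝ) ≤ (2 * G.adm r) ^ r := by exact_mod_cast wcol_le_pow G r
    _ ≤ (2 * admCoeff H * r) ^ r := by rw [mul_assoc]; gcongr; exact adm_le V G hG r hr
    _ ≤ c * (r : ℝ) ^ ((1 + ε) * (r : ℝ)) := hc r hr
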